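/- Let $(\Omega,\Sigma,\mu)$ be a probability space and let $\varphi\colon\Omega\to\Omega$ be a measurable map with $\mu(\varphi^{-1}(A))=\mu(A)$ for all $A\in\Sigma$. Assume that $\varphi$ is bimeasurable, i.e. also $\varphi(A)\in\Sigma$ for every $A\in\Sigma$. Let $L^1=L^1(\Omega,\Sigma,\mu)$ be the space of (classes of) real-valued integrable functions, and let $P\colon L^1\to L^1$ be the Perron–Frobenius operator, i.e. the unique positive linear operator with $$\int_A Pf\,d\mu=\int_{\varphi^{-1}(A)}f\,d\mu\qquad(f\in L^1,\ A\in\Sigma).$$ Write $A\sim B$ if $\mu(A\triangle B)=0$, and let $\Sigma/{\sim}$ be the measure algebra with the metric $d(A,B)=\mu(A\triangle B)$. Put $$\Sigma_\infty=\bigcap_{n\in\mathbb N}\{\varphi^{-n}(A):A\in\Sigma\},\qquad \Sigma_{\mathrm{inv}}=\{A\in\Sigma:\varphi^{-1}(A)=A\},$$ and for a sub-$\sigma$-algebra $\mathcal A\subseteq\Sigma$ let $\overline{\mathcal A}=\{A\in\Sigma: A\sim B\text{ for some }B\in\mathcal A\}$ be its completion within $\Sigma$. For $A\subseteq\Omega$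 let the minimal invariant superset $A^*$ be the intersection of all $B\subseteq\Omega$ with $A\subseteq B$ and $\varphi^{-1}(B)=B$. Then the following assertions are equivalent: (i) for every $A\in\Sigma$ the sequence $(\varphi^n(A))_{n\in\mathbb N}$ converges in $\Sigma/{\sim}$; (ii) for every $f\in L^1$ the sequence $(P^nf)_{n\in\mathbb N}$ converges in $L^1$; (iii) $\overline{\Sigma_\infty}=\overline{\Sigma_{\mathrm{inv}}}$. If these equivalent assertions hold, then for every $f\in L^1$ the sequence $(P^nf)_{n\in\mathbb N}$ converges in $L^1$ to the conditional expectation $\mathbb E(f\mid\Sigma_{\mathrm{inv}})$, and for every $A\in\Sigma$ the set $A^*$ belongs to $\Sigma$ and $(\varphi^n(A))_{n\in\mathbb N}$ converges to $A^*$ in $\Sigma/{\sim}$. -/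

import Mathlib

open MeasureTheory Filter Topology
open scoped symmDiff

noncomputable section

namespace PerronFrobenius

/-- A self-map is bimeasurable if preimages and images of measurable sets are measurable. -/
structure Bimeasurable {Ω : Type*} [MeasurableSpace Ω] (φ : Ω → Ω) : Prop where
  measurable : Measurable φ
  measurableSet_image : ∀ A : Set Ω, MeasurableSet A → MeasurableSet (φ '' A)

theorem Bimeasurable.measurableSet_iterate_image {Ω : Type*} [MeasurableSpace Ω] {φ : Ω → Ω}
    (hφ : Bimeasurable φ) (n : ℕ) {A : Set Ω} (hA : MeasurableSet A) :
    MeasurableSet (φ^[n] '' A) := by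
  induction n with
  | zero => simpa using hA
  | succ n ih =>
    rw [Function.iterate_succ', Set.image_comp]
    exact hφ.measurableSet_image _ ih

/-- The measure algebra `Σ/∼`: measurable sets modulo `μ (A ∆ B) = 0`, with the metric
`d(A, B) = μ (A ∆ B)`. (`MeasuredSets μ` is the space of measurable sets with this pseudometric.) -/
abbrev MeasureAlgebra {Ω : Type*} [MeasurableSpace Ω] (μ : Measure Ω) : Type _ :=
  SeparationQuotient (MeasuredSets μ)

/-- The class of a measurable set in the measure algebra. -/
def MeasureAlgebra.mk {Ω : Type*} [MeasurableSpace Ω] (μ : Measure Ω) (A : Set Ω)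
    (hA : MeasurableSet A) : MeasureAlgebra μ :=
  SeparationQuotient.mk (⟨A, hA⟩ : MeasuredSets μ)

theorem MeasureAlgebra.edist_mk {Ω : Type*} [MeasurableSpace Ω] (μ : Measure Ω) {A B : Set Ω}
    (hA : MeasurableSet A) (hB : MeasurableSet B) :
    edist (MeasureAlgebra.mk μ A hA) (MeasureAlgebra.mk μ B hB) = μ (A ∆ B) := rfl

theorem MeasureAlgebra.mk_eq_mk {Ω : Type*} [MeasurableSpace Ω] (μ : Measure Ω) {A B : Set Ω}
    (hA : MeasurableSet A) (hB : MeasurableSet B) :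
    MeasureAlgebra.mk μ A hA = MeasureAlgebra.mk μ B hB ↔ μ (A ∆ B) = 0 := by
  rw [← MeasureAlgebra.edist_mk μ hA hB, edist_eq_zero]

/-- `Σ_∞ = ⋂ n, Σ_n`, where `Σ_n = {φ⁻ⁿ(A) : A ∈ Σ}`. -/
abbrev tailSigma {Ω : Type*} [mΩ : MeasurableSpace Ω] (φ : Ω → Ω) : MeasurableSpace Ω :=
  ⨅ n : ℕ, MeasurableSpace.comap (φ^[n]) mΩ

theorem measurableSet_tailSigma {Ω : Type*} [MeasurableSpace Ω] {φ : Ω → Ω} {A : Set Ω} :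
    MeasurableSet[tailSigma φ] A ↔ ∀ n : ℕ, ∃ B, MeasurableSet B ∧ φ^[n] ⁻¹' B = A := by
  rw [MeasurableSpace.measurableSet_iInf]
  rfl

/-- The completion of a sub-σ-algebra `m` within `Σ`: all sets in `Σ` that agree with a set of `m`
up to a `μ`-null set. -/
abbrev completionWithin {Ω : Type*} (m : MeasurableSpace Ω) [mΩ : MeasurableSpace Ω]
    (μ : Measure Ω) : MeasurableSpace Ω :=
  mΩ ⊓ eventuallyMeasurableSpace m (ae μ)

theorem measurableSet_completionWithin {Ω : Type*} {m : MeasurableSpace Ω}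
    [mΩ : MeasurableSpace Ω] {μ : Measure Ω} {A : Set Ω} :
    MeasurableSet[completionWithin m μ] A ↔
      MeasurableSet[mΩ] A ∧ ∃ B, MeasurableSet[m] B ∧ μ (A ∆ B) = 0 := by
  rw [MeasurableSpace.measurableSet_inf]
  simp only [measure_symmDiff_eq_zero_iff]
  rfl

/-- The minimal invariant superset `A*`: the intersection of all (not necessarily measurable)
`B ⊇ A` with `φ⁻¹(B) = B`. -/
def minimalInvariantSuperset {Ω : Type*} (φ : Ω → Ω) (A : Set Ω) : Set Ω :=
  ⋂₀ {B | A ⊆ B ∧ φ ⁻¹' B = B}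

/-- The conditional expectation `𝔼(f | Σ_inv)` as an element of `L¹`. -/
def condExpInv {Ω : Type*} [MeasurableSpace Ω] (μ : Measure Ω) (φ : Ω → Ω) (f : Lp ℝ 1 μ) :
    Lp ℝ 1 μ :=
  (integrable_condExp (m := MeasurableSpace.invariants φ) (μ := μ) (f := f)).toL1
    (μ[f | MeasurableSpace.invariants φ])

section Operator

variable {Ω : Type*} [MeasurableSpace Ω] {μ : Measure Ω} {φ : Ω → Ω}

theorem ext_of_setIntegral_eq {f g : Lp ℝ 1 μ}
    (h : ∀ A, MeasurableSet A → ∫ x in A, f x ∂μ = ∫ x in A, g x ∂μ) : f = g :=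
  Lp.ext ((L1.integrable_coeFn f).ae_eq_of_forall_setIntegral_eq _ _ (L1.integrable_coeFn g)
    fun A hA _ => h A hA)

theorem setIntegral_add (f g : Lp ℝ 1 μ) (A : Set Ω) :
    ∫ x in A, (f + g : Lp ℝ 1 μ) x ∂μ = ∫ x in A, f x ∂μ + ∫ x in A, g x ∂μ := by
  rw [← integral_add (L1.integrable_coeFn f).integrableOn (L1.integrable_coeFn g).integrableOn]
  exact integral_congr_ae (ae_restrict_of_ae (Lp.coeFn_add f g))

theorem setIntegral_smul (c : ℝ) (f : Lp ℝ 1 μ) (A : Set Ω) :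
    ∫ x in A, (c • f : Lp ℝ 1 μ) x ∂μ = c • ∫ x in A, f x ∂μ := by
  rw [← integral_smul]
  exact integral_congr_ae (ae_restrict_of_ae (Lp.coeFn_smul c f))

/-- `P f` as the Radon-Nikodym derivative with respect to `μ` of the signed measure
`A ↦ ∫ x in φ⁻¹(A), f x ∂μ`. -/
def pfFun (μ : Measure Ω) (φ : Ω → Ω) (f : Lp ℝ 1 μ) : Lp ℝ 1 μ :=
  (SignedMeasure.integrable_rnDeriv ((μ.withDensityᵥ f).map φ) μ).toL1 _

variable [IsProbabilityMeasure μ]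

theorem setIntegral_pfFun (hφ : MeasurePreserving φ μ μ) (f : Lp ℝ 1 μ) {A : Set Ω}
    (hA : MeasurableSet A) : ∫ x in A, pfFun μ φ f x ∂μ = ∫ x in φ ⁻¹' A, f x ∂μ := by
  have hf := L1.integrable_coeFn f
  set s : SignedMeasure Ω := (μ.withDensityᵥ f).map φ with hs
  have happ : ∀ B, MeasurableSet B → s B = ∫ x in φ ⁻¹' B, f x ∂μ := fun B hB => by
    rw [hs, VectorMeasure.map_apply _ hφ.measurable hB,
      withDensityᵥ_apply hf (hφ.measurable hB)]
  have hac : VectorMeasure.AbsolutelyContinuous s μ.toENNRealVectorMeasure := by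
    refine VectorMeasure.AbsolutelyContinuous.mk fun B hB hB0 => ?_
    rw [Measure.toENNRealVectorMeasure_apply_measurable hB] at hB0
    rw [happ B hB]
    exact setIntegral_measure_zero _
      ((hφ.measure_preimage hB.nullMeasurableSet).trans hB0)
  have hrn := (SignedMeasure.absolutelyContinuous_iff_withDensityᵥ_rnDeriv_eq s μ).1 hac
  rw [← happ A hA, ← hrn, withDensityᵥ_apply (SignedMeasure.integrable_rnDeriv s μ) hA]
  refine integral_congr_ae (ae_restrict_of_ae ?_)
  exact (SignedMeasure.integrable_rnDeriv s μ).coeFn_toL1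

theorem pfFun_nonneg (hφ : MeasurePreserving φ μ μ) {f : Lp ℝ 1 μ} (hf : 0 ≤ f) :
    0 ≤ pfFun μ φ f := by
  rw [← Lp.coeFn_nonneg] at hf ⊢
  refine ae_nonneg_of_forall_setIntegral_nonneg (L1.integrable_coeFn _) fun A hA _ => ?_
  rw [setIntegral_pfFun hφ f hA]
  exact integral_nonneg_of_ae (ae_restrict_of_ae hf)

/-- `P` as a linear map. -/
def pfLinear (hφ : MeasurePreserving φ μ μ) : Lp ℝ 1 μ →ₗ[ℝ] Lp ℝ 1 μ where
  toFun := pfFun μ φ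
  map_add' f g := ext_of_setIntegral_eq fun A hA => by
    rw [setIntegral_pfFun hφ _ hA, setIntegral_add, setIntegral_add, setIntegral_pfFun hφ _ hA,
      setIntegral_pfFun hφ _ hA]
  map_smul' c f := ext_of_setIntegral_eq fun A hA => by
    rw [setIntegral_pfFun hφ _ hA, setIntegral_smul, RingHom.id_apply, setIntegral_smul,
      setIntegral_pfFun hφ _ hA]

theorem norm_pfLinear_le (hφ : MeasurePreserving φ μ μ) (f : Lp ℝ 1 μ) :
    ‖pfLinear hφ f‖ ≤ 1 * ‖f‖ := by
  have h0 : ∀ g : Lp ℝ 1 μ, ∫ x, (pfLinear hφ g) x ∂μ = ∫ x, g x ∂μ := fun g => by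
    have h := setIntegral_pfFun hφ g MeasurableSet.univ
    rw [Set.preimage_univ, setIntegral_univ, setIntegral_univ] at h
    exact h
  have hle : |pfLinear hφ f| ≤ pfLinear hφ |f| := by
    rw [abs_le', ← map_neg, ← sub_nonneg, ← map_sub, ← sub_nonneg (b := pfLinear hφ (-f)),
      ← map_sub]
    exact ⟨pfFun_nonneg hφ (sub_nonneg.2 (le_abs_self f)),
      pfFun_nonneg hφ (sub_nonneg.2 (neg_le_abs f))⟩
  have hn : ∀ g : Lp ℝ 1 μ, ‖g‖ = ∫ x, (|g| : Lp ℝ 1 μ) x ∂μ := fun g => by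
    rw [L1.norm_eq_integral_norm]
    refine integral_congr_ae ?_
    filter_upwards [Lp.coeFn_abs g] with x hx
    rw [hx, Real.norm_eq_abs]
  rw [one_mul, hn, hn f, ← h0 |f|]
  exact integral_mono_ae (L1.integrable_coeFn _) (L1.integrable_coeFn _) (Lp.coeFn_le _ _ |>.2 hle)

/-- The Perron-Frobenius operator on `L¹`. -/
def perronFrobenius (hφ : MeasurePreserving φ μ μ) : Lp ℝ 1 μ →L[ℝ] Lp ℝ 1 μ :=
  (pfLinear hφ).mkContinuous 1 (norm_pfLinear_le hφ)

/-- The defining property of the Perron-Frobenius operator. -/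
theorem setIntegral_perronFrobenius (hφ : MeasurePreserving φ μ μ) (f : Lp ℝ 1 μ) {A : Set Ω}
    (hA : MeasurableSet A) :
    ∫ x in A, perronFrobenius hφ f x ∂μ = ∫ x in φ ⁻¹' A, f x ∂μ :=
  setIntegral_pfFun hφ f hA

theorem perronFrobenius_nonneg (hφ : MeasurePreserving φ μ μ) {f : Lp ℝ 1 μ} (hf : 0 ≤ f) :
    0 ≤ perronFrobenius hφ f :=
  pfFun_nonneg hφ hf

/-- The defining property determines the operator. -/
theorem eq_perronFrobenius (hφ : MeasurePreserving φ μ μ) (Q : Lp ℝ 1 μ → Lp ℝ 1 μ)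
    (hQ : ∀ (f : Lp ℝ 1 μ) (A : Set Ω), MeasurableSet A →
      ∫ x in A, Q f x ∂μ = ∫ x in φ ⁻¹' A, f x ∂μ) : Q = perronFrobenius hφ :=
  funext fun f => ext_of_setIntegral_eq fun A hA => by
    rw [hQ f A hA, setIntegral_perronFrobenius hφ f hA]

end Operator

end PerronFrobenius

end

/-!
Transporting `Pⁿ f` back along `φⁿ` gives `Pⁿ f ∘ φⁿ = 𝔼(f | φ⁻ⁿ(Σ))`, which converges in `L¹` to
`𝔼(f | Σ_∞)` by Lévy's downward theorem. If `Σ_∞` and `Σ_inv` agree up to null sets, this limit is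
the `φ`-invariant function `𝔼(f | Σ_inv)`, so it is the limit of `Pⁿ f` as well. For sets, the
`φ⁻ⁿ(φⁿ(A))` increase to a set of `Σ_∞`; once that set is invariant up to a null set it must agree
with `A*` up to a null set, so `μ(φⁿ(A))` increases to `μ(A*)` while `φⁿ(A) ⊆ A*`.

Conversely, preimage under `φ` and composition with `φ` are isometries `U`, and an element `x` that
is measurable with respect to `Σ_∞` has the form `Uⁿ(uₙ)` for every `n`, with `uₙ = φⁿ(x)` or
`uₙ = Pⁿ x`. If `uₙ → y`, then `Uⁿ(y) → x`, hence also `Uⁿ⁺¹(y) → U(x)`, and therefore `U(x) = x`.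
-/

namespace PerronFrobenius

theorem isometry_iterate {X : Type*} [PseudoEMetricSpace X] {U : X → X} (hU : Isometry U) (n : ℕ) :
    Isometry U^[n] := by
  induction n with
  | zero => exact isometry_id
  | succ n ih => exact ih.comp hU

theorem inseparable_of_tendsto_of_iterate_eq {X : Type*} [PseudoEMetricSpace X] {U : X → X}
    (hU : Isometry U) {x y : X} {u : ℕ → X} (hu : ∀ n, U^[n] (u n) = x)
    (hy : Tendsto u atTop (𝓝 y)) : Inseparable (U x) x := by
  have hx : Tendsto (fun n => U^[n] y) atTop (𝓝 x) := by
    rw [tendsto_iff_edist_tendsto_0] at hy ⊢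
    refine hy.congr fun n => ?_
    rw [← (isometry_iterate hU n).edist_eq, hu n, edist_comm]
  have hUx : Tendsto (fun n => U^[n + 1] y) atTop (𝓝 (U x)) := by
    simp_rw [Function.iterate_succ_apply']
    exact (hU.continuous.tendsto x).comp hx
  exact tendsto_nhds_unique_inseparable hUx (hx.comp (tendsto_add_atTop_nat 1))

section MeasurePreserving

variable {X Y : Type*} [MeasurableSpace X] [MeasurableSpace Y] {ν : Measure X} {ρ : Measure Y}
  {f : X → Y}

theorem tendsto_measure_symmDiff_of_subset {ι : Type*} {l : Filter ι} {s : ι → Set X} {t : Set X}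
    (hs : ∀ i, NullMeasurableSet (s i) ν) (hst : ∀ i, s i ⊆ t) (ht : ν t ≠ ⊤)
    (h : Tendsto (fun i => ν (s i)) l (𝓝 (ν t))) :
    Tendsto (fun i => ν (s i ∆ t)) l (𝓝 0) := by
  have hdiff : ∀ i, ν (s i ∆ t) = ν t - ν (s i) := fun i => by
    rw [symmDiff_of_le (hst i), measure_sdiff (hst i) (hs i) (measure_ne_top_of_subset (hst i) ht)]
  simp_rw [hdiff]
  simpa only [tsub_self] using ENNReal.Tendsto.sub (tendsto_const_nhds (x := ν t)) h (Or.inl ht)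

theorem ae_le_of_preimage_ae_le (hf : MeasurePreserving f ν ρ) {s t : Set Y}
    (hs : NullMeasurableSet s ρ) (ht : NullMeasurableSet t ρ) (h : f ⁻¹' s ≤ᵐ[ν] f ⁻¹' t) :
    s ≤ᵐ[ρ] t := by
  rw [ae_le_set] at h ⊢
  rwa [← hf.measure_preimage (hs.diff ht)]

/-- Taking preimages under a measurable map, as a map between spaces of measurable sets with the
pseudometric given by the measure of `s ∆ t`; it is an isometry when the map is measure
preserving. -/
def preimageMeasuredSets (ν : Measure X) (ρ : Measure Y) {f : X → Y} (hf : Measurable f)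
    (s : MeasuredSets ρ) : MeasuredSets ν :=
  ⟨f ⁻¹' s, hf s.2⟩

theorem isometry_preimageMeasuredSets (hf : MeasurePreserving f ν ρ) :
    Isometry (preimageMeasuredSets ν ρ hf.measurable) := fun s t =>
  hf.measure_preimage (s.2.symmDiff t.2).nullMeasurableSet

theorem coe_preimageMeasuredSets_iterate {T : X → X} (hT : Measurable T) (n : ℕ)
    (s : MeasuredSets ν) :
    ((preimageMeasuredSets ν ν hT)^[n] s : Set X) = T^[n] ⁻¹' s := by
  induction n generalizing s with
  | zero => rfl
  | succ n ih =>
    rw [Function.iterate_succ_apply, ih, Function.iterate_succ', Set.preimage_comp]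
    rfl

end MeasurePreserving

section LevyDownward

theorem tendsto_starProjection_iInf {𝕜 E ι : Type*} [RCLike 𝕜] [NormedAddCommGroup E]
    [InnerProductSpace 𝕜 E] [CompleteSpace E] [Preorder ι] (K : ι → Submodule 𝕜 E)
    [∀ i, (K i).HasOrthogonalProjection] [(⨅ i, K i).HasOrthogonalProjection] (hK : Antitone K)
    (x : E) :
    Tendsto (fun i => (K i).starProjection x) atTop (𝓝 ((⨅ i, K i).starProjection x)) := by
  have hclosure : (⨆ i, (K i)ᗮ).topologicalClosure = (⨅ i, K i)ᗮ := by
    simp_rw [← Submodule.orthogonal_orthogonal_eq_closure, ← Submodule.iInf_orthogonal,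
      Submodule.orthogonal_orthogonal]
  have h := Submodule.starProjection_tendsto_closure_iSup (fun i => (K i)ᗮ)
    (fun i j hij => Submodule.orthogonal_le (hK hij)) x
  simp_rw [hclosure, Submodule.starProjection_orthogonal_val] at h
  simpa only [sub_sub_cancel] using (tendsto_const_nhds (x := x)).sub h

theorem stronglyMeasurable_iInf {ι Ω E : Type*} [Nonempty ι] [TopologicalSpace E]
    [TopologicalSpace.PseudoMetrizableSpace E] {G : ι → MeasurableSpace Ω} {f : Ω → E}
    (hf : ∀ i, StronglyMeasurable[G i] f) : StronglyMeasurable[⨅ i, G i] f := by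
  borelize E
  obtain ⟨i⟩ := ‹Nonempty ι›
  refine stronglyMeasurable_iff_measurable_separable.2 ⟨fun s hs => ?_, (hf i).isSeparable_range⟩
  exact MeasurableSpace.measurableSet_iInf.2 fun j => (hf j).measurable hs

variable {Ω E : Type*} [mΩ : MeasurableSpace Ω] {μ : Measure Ω} {F : ℕ → MeasurableSpace Ω}

theorem aestronglyMeasurable_iInf [TopologicalSpace E]
    [TopologicalSpace.IsCompletelyMetrizableSpace E] [Nonempty E]
    (hF : Antitone F) {f : Ω → E} (hf : ∀ n, AEStronglyMeasurable[F n] f μ) :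
    AEStronglyMeasurable[⨅ n, F n] f μ := by
  choose g hgm hfg using hf
  refine ⟨fun x => limUnder atTop fun n => g n x, stronglyMeasurable_iInf fun k => ?_, ?_⟩
  · have hshift : ∀ x, limUnder atTop (fun n => g n x) = limUnder atTop fun n => g (n + k) x :=
      fun x => by
        conv_lhs => rw [limUnder, ← map_add_atTop_eq_nat k, map_map]
        rfl
    simp_rw [hshift]
    let _ := F k
    exact StronglyMeasurable.limUnder fun n => (hgm (n + k)).mono (hF (Nat.le_add_left k n))
  · filter_upwards [ae_all_iff.2 hfg] with x hx
    simp only [← hx, tendsto_const_nhds.limUnder_eq]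

variable [NormedAddCommGroup E]

theorem iInf_lpMeas {𝕜 : Type*} [RCLike 𝕜] [NormedSpace 𝕜 E] [CompleteSpace E]
    (hF : Antitone F) (p : ENNReal) :
    ⨅ n, lpMeas E 𝕜 (F n) p μ = lpMeas E 𝕜 (⨅ n, F n) p μ := by
  ext f
  simp only [Submodule.mem_iInf, mem_lpMeas_iff_aestronglyMeasurable]
  exact ⟨aestronglyMeasurable_iInf hF, fun h n => h.mono (iInf_le F n)⟩

theorem eLpNorm_condExp_sub_condExp_le [NormedSpace ℝ E] [CompleteSpace E] {f g : Ω → E}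
    (hf : Integrable f μ) (hg : Integrable g μ) (m m' : MeasurableSpace Ω) :
    eLpNorm (μ[f | m] - μ[f | m']) 1 μ ≤
      eLpNorm (f - g) 1 μ + eLpNorm (μ[g | m] - μ[g | m']) 1 μ + eLpNorm (f - g) 1 μ := by
  have hmeas : ∀ (n : MeasurableSpace Ω) (u : Ω → E), AEStronglyMeasurable[mΩ] (μ[u | n]) μ :=
    fun n u => integrable_condExp.aestronglyMeasurable
  have hclose : ∀ n : MeasurableSpace Ω, eLpNorm (μ[f | n] - μ[g | n]) 1 μ ≤ eLpNorm (f - g) 1 μ :=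
    fun n => (eLpNorm_congr_ae (condExp_sub hf hg n).symm).trans_le
      (eLpNorm_condExp_le_eLpNorm _ le_rfl)
  have hsplit : μ[f | m] - μ[f | m'] =
      (μ[f | m] - μ[g | m]) + (μ[g | m] - μ[g | m']) - (μ[f | m'] - μ[g | m']) := by abel
  rw [hsplit]
  refine (eLpNorm_sub_le (((hmeas _ _).sub (hmeas _ _)).add ((hmeas _ _).sub (hmeas _ _)))
    ((hmeas _ _).sub (hmeas _ _)) le_rfl).trans (add_le_add ?_ (hclose m'))
  refine (eLpNorm_add_le ((hmeas _ _).sub (hmeas _ _))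
    ((hmeas _ _).sub (hmeas _ _)) le_rfl).trans (add_le_add (hclose m) le_rfl)

variable [InnerProductSpace ℝ E] [CompleteSpace E] [IsFiniteMeasure μ] {f : Ω → E}

theorem tendsto_eLpNorm_two_condExp_iInf (hF : Antitone F) (hle : ∀ n, F n ≤ mΩ)
    (hf : MemLp f 2 μ) :
    Tendsto (fun n => eLpNorm (μ[f | F n] - μ[f | ⨅ n, F n]) 2 μ) atTop (𝓝 0) := by
  have hle' : ⨅ n, F n ≤ mΩ := (iInf_le F 0).trans (hle 0)
  have : ∀ n, Fact (F n ≤ mΩ) := fun n => ⟨hle n⟩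
  have : Fact (⨅ n, F n ≤ mΩ) := ⟨hle'⟩
  have : (⨅ n, lpMeas E ℝ (F n) 2 μ).HasOrthogonalProjection := by
    rw [iInf_lpMeas hF]
    infer_instance
  have hanti : Antitone fun n => lpMeas E ℝ (F n) 2 μ := fun i j hij g hg => by
    rw [mem_lpMeas_iff_aestronglyMeasurable] at hg ⊢
    exact hg.mono (hF hij)
  have h := tendsto_starProjection_iInf _ hanti hf.toLp
  simp_rw [iInf_lpMeas hF] at h
  rw [Lp.tendsto_Lp_iff_tendsto_eLpNorm'] at h
  refine h.congr fun n => eLpNorm_congr_ae ?_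
  exact (hf.condExpL2_ae_eq_condExp (𝕜 := ℝ) (hle n)).sub
    (hf.condExpL2_ae_eq_condExp (𝕜 := ℝ) hle')

theorem tendsto_eLpNorm_one_condExp_iInf_of_memLp_two (hF : Antitone F) (hle : ∀ n, F n ≤ mΩ)
    (hf : MemLp f 2 μ) :
    Tendsto (fun n => eLpNorm (μ[f | F n] - μ[f | ⨅ n, F n]) 1 μ) atTop (𝓝 0) := by
  have hbound : ∀ n, eLpNorm (μ[f | F n] - μ[f | ⨅ n, F n]) 1 μ ≤
      eLpNorm (μ[f | F n] - μ[f | ⨅ n, F n]) 2 μ * μ Set.univ ^ (1 / 1 - 1 / 2 : ℝ) := fun n =>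
    eLpNorm_le_eLpNorm_mul_rpow_measure_univ one_le_two
      (integrable_condExp.sub integrable_condExp).aestronglyMeasurable
  have hlim := ENNReal.Tendsto.mul_const (tendsto_eLpNorm_two_condExp_iInf hF hle hf)
    (b := μ Set.univ ^ (1 / 1 - 1 / 2 : ℝ)) (Or.inr (by finiteness))
  rw [zero_mul] at hlim
  exact tendsto_of_tendsto_of_tendsto_of_le_of_le tendsto_const_nhds hlim (fun _ => zero_le) hbound

theorem tendsto_eLpNorm_one_condExp_iInf (hF : Antitone F) (hle : ∀ n, F n ≤ mΩ)
    (hf : Integrable f μ) :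
    Tendsto (fun n => eLpNorm (μ[f | F n] - μ[f | ⨅ n, F n]) 1 μ) atTop (𝓝 0) := by
  refine ENNReal.tendsto_nhds_zero.2 fun ε hε => ?_
  have hε' : 0 < ε / 3 := ENNReal.div_pos hε.ne' (by simp)
  obtain ⟨g, hfg, -⟩ := (memLp_one_iff_integrable.2 hf).exists_simpleFunc_eLpNorm_sub_lt
    ENNReal.one_ne_top hε'.ne'
  have hg : MemLp g 2 μ := g.memLp_of_isFiniteMeasure 2 μ
  filter_upwards [ENNReal.tendsto_nhds_zero.1
    (tendsto_eLpNorm_one_condExp_iInf_of_memLp_two hF hle hg) (ε / 3) hε'] with n hn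
  calc eLpNorm (μ[f | F n] - μ[f | ⨅ n, F n]) 1 μ
      ≤ eLpNorm (f - ⇑g) 1 μ + eLpNorm (μ[g | F n] - μ[g | ⨅ n, F n]) 1 μ +
          eLpNorm (f - ⇑g) 1 μ :=
        eLpNorm_condExp_sub_condExp_le hf (hg.integrable one_le_two) _ _
    _ ≤ ε / 3 + ε / 3 + ε / 3 := by gcongr
    _ = ε := ENNReal.add_thirds ε

end LevyDownward

section Completion

variable {Ω : Type*} {m m' : MeasurableSpace Ω} [mΩ : MeasurableSpace Ω] {μ : Measure Ω}

theorem completionWithin_eq_iff_le (hmm' : m ≤ m') (hm' : m' ≤ mΩ) :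
    completionWithin m' μ = completionWithin m μ ↔ m' ≤ completionWithin m μ := by
  refine ⟨fun h => ?_, fun h => le_antisymm ?_ ?_⟩
  · exact h ▸ le_inf hm' le_eventuallyMeasurableSpace
  · rintro A ⟨hA, B, hB, hAB⟩
    obtain ⟨-, C, hC, hBC⟩ := h B hB
    exact ⟨hA, C, hC, hAB.trans hBC⟩
  · rintro A ⟨hA, B, hB, hAB⟩
    exact ⟨hA, B, hmm' B hB, hAB⟩

theorem condExp_ae_eq_of_le_completionWithin {E : Type*} [NormedAddCommGroup E] [NormedSpace ℝ E]
    [CompleteSpace E] [IsFiniteMeasure μ] (hmm' : m ≤ m') (h : m' ≤ completionWithin m μ)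
    {f : Ω → E} (hf : Integrable f μ) : μ[f | m] =ᵐ[μ] μ[f | m'] := by
  have hm' : m' ≤ mΩ := h.trans inf_le_left
  refine ae_eq_condExp_of_forall_setIntegral_eq hm' hf
    (fun _ _ _ => integrable_condExp.integrableOn) (fun A hA _ => ?_)
    (stronglyMeasurable_condExp.mono hmm').aestronglyMeasurable
  obtain ⟨-, B, hB, hAB⟩ := h A hA
  rw [setIntegral_congr_set hAB, setIntegral_congr_set hAB,
    setIntegral_condExp (hmm'.trans hm') hf hB]

end Completion

section Saturation

variable {Ω : Type*} {φ : Ω → Ω} {A : Set Ω}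

/-- The increasing union of the sets `φ⁻ⁿ(φⁿ(A))`. It is the smallest set containing `A` that
is a preimage under every iterate of `φ`. -/
def tailSaturation (φ : Ω → Ω) (A : Set Ω) : Set Ω :=
  ⋃ n : ℕ, φ^[n] ⁻¹' (φ^[n] '' A)

theorem monotone_preimage_image_iterate (φ : Ω → Ω) (A : Set Ω) :
    Monotone fun n : ℕ => φ^[n] ⁻¹' (φ^[n] '' A) := by
  refine monotone_nat_of_le_succ fun n x ⟨a, ha, hax⟩ => ⟨a, ha, ?_⟩
  rw [Function.iterate_succ_apply', Function.iterate_succ_apply', hax]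

theorem preimage_iterate_eq_of_preimage_eq {B : Set Ω} (hB : φ ⁻¹' B = B) (n : ℕ) :
    φ^[n] ⁻¹' B = B :=
  Function.IsFixedPt.preimage_iterate hB n

theorem minimalInvariantSuperset_eq_iUnion (φ : Ω → Ω) (A : Set Ω) :
    minimalInvariantSuperset φ A = ⋃ m : ℕ, φ^[m] ⁻¹' ⋃ n : ℕ, φ^[n] '' A := by
  refine Set.Subset.antisymm (Set.sInter_subset_of_mem ⟨fun x hx => ?_, Set.ext fun x => ?_⟩)
    (Set.subset_sInter fun B ⟨hAB, hB⟩ => Set.iUnion_subset fun m => ?_)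
  · exact Set.mem_iUnion.2 ⟨0, Set.mem_iUnion.2 ⟨0, x, hx, rfl⟩⟩
  · simp only [Set.mem_preimage, Set.mem_iUnion]
    refine ⟨fun ⟨m, n, h⟩ => ⟨m + 1, n, h⟩, fun ⟨m, n, a, ha, h⟩ => ⟨m, n + 1, a, ha, ?_⟩⟩
    rw [Function.iterate_succ_apply', h, ← Function.iterate_succ_apply' φ m,
      Function.iterate_succ_apply]
  · have hforward : ⋃ n : ℕ, φ^[n] '' A ⊆ B := Set.iUnion_subset fun n => by
      rw [Set.image_subset_iff, preimage_iterate_eq_of_preimage_eq hB]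
      exact hAB
    exact (Set.preimage_mono hforward).trans_eq (preimage_iterate_eq_of_preimage_eq hB m)

theorem image_iterate_subset_minimalInvariantSuperset (φ : Ω → Ω) (A : Set Ω) (n : ℕ) :
    φ^[n] '' A ⊆ minimalInvariantSuperset φ A := by
  rw [minimalInvariantSuperset_eq_iUnion]
  exact fun x hx => Set.mem_iUnion.2 ⟨0, Set.mem_iUnion.2 ⟨n, hx⟩⟩

theorem tailSaturation_subset_minimalInvariantSuperset (φ : Ω → Ω) (A : Set Ω) :
    tailSaturation φ A ⊆ minimalInvariantSuperset φ A := by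
  rw [minimalInvariantSuperset_eq_iUnion]
  exact Set.iUnion_mono fun n => Set.preimage_mono (Set.subset_iUnion (fun k => φ^[k] '' A) n)

end Saturation

section Invariance

variable {Ω : Type*} [mΩ : MeasurableSpace Ω] {μ : Measure Ω} {φ : Ω → Ω} {A : Set Ω}

theorem antitone_comap_iterate (hφ : Measurable φ) :
    Antitone fun n : ℕ => MeasurableSpace.comap (φ^[n]) mΩ := by
  refine antitone_nat_of_succ_le fun n => ?_
  rw [Function.iterate_succ', ← MeasurableSpace.comap_comp]
  exact MeasurableSpace.comap_mono hφ.comap_le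

theorem tailSigma_le (φ : Ω → Ω) : tailSigma φ ≤ mΩ :=
  (iInf_le _ 0).trans_eq MeasurableSpace.comap_id

theorem invariants_le_tailSigma (φ : Ω → Ω) : MeasurableSpace.invariants φ ≤ tailSigma φ :=
  fun B ⟨hB, hinv⟩ =>
    measurableSet_tailSigma.2 fun n => ⟨B, hB, preimage_iterate_eq_of_preimage_eq hinv n⟩

theorem preimage_image_iterate_of_tailSigma (hA : MeasurableSet[tailSigma φ] A) (n : ℕ) :
    φ^[n] ⁻¹' (φ^[n] '' A) = A := by
  obtain ⟨B, -, rfl⟩ := measurableSet_tailSigma.1 hA n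
  exact Set.preimage_image_preimage

theorem tailSigma_le_completionWithin_invariants (hφ : Measure.QuasiMeasurePreserving φ μ μ)
    (h : ∀ A, MeasurableSet[tailSigma φ] A → φ ⁻¹' A =ᵐ[μ] A) :
    tailSigma φ ≤ completionWithin (MeasurableSpace.invariants φ) μ := fun A hA => by
  have hA' := tailSigma_le φ A hA
  obtain ⟨B, hB, hBA, hinv⟩ :=
    hφ.exists_preimage_eq_of_preimage_ae hA'.nullMeasurableSet (h A hA)
  exact ⟨hA', B, ⟨hB, hinv⟩, hBA.symm⟩

theorem measurableSet_tailSaturation (hbi : Bimeasurable φ) (hA : MeasurableSet A) :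
    MeasurableSet[tailSigma φ] (tailSaturation φ A) := by
  refine MeasurableSpace.measurableSet_iInf.2 fun k => ?_
  rw [tailSaturation, ← (monotone_preimage_image_iterate φ A).iUnion_nat_add k]
  exact MeasurableSet.iUnion fun n => antitone_comap_iterate hbi.measurable (Nat.le_add_left k n) _
    ⟨_, hbi.measurableSet_iterate_image (n + k) hA, rfl⟩

theorem measurableSet_minimalInvariantSuperset (hbi : Bimeasurable φ) (hA : MeasurableSet A) :
    MeasurableSet (minimalInvariantSuperset φ A) := by
  rw [minimalInvariantSuperset_eq_iUnion]
  exact MeasurableSet.iUnion fun m => hbi.measurable.iterate m <|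
    MeasurableSet.iUnion fun n => hbi.measurableSet_iterate_image n hA

theorem minimalInvariantSuperset_ae_le (hφ : MeasurePreserving φ μ μ) (hbi : Bimeasurable φ)
    (hA : MeasurableSet A) {B : Set Ω} (hB : MeasurableSet[MeasurableSpace.invariants φ] B)
    (hAB : tailSaturation φ A ≤ᵐ[μ] B) : minimalInvariantSuperset φ A ≤ᵐ[μ] B := by
  obtain ⟨hBm, hinv⟩ := hB
  -- Images of null sets need not be null, so the inequality is first tested on `φ⁻ⁿ(φⁿ(A))`.
  have himage : ∀ n : ℕ, (φ^[n] '' A : Set Ω) ≤ᵐ[μ] B := fun n => by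
    refine ae_le_of_preimage_ae_le (hφ.iterate n)
      (hbi.measurableSet_iterate_image n hA).nullMeasurableSet hBm.nullMeasurableSet ?_
    rw [preimage_iterate_eq_of_preimage_eq hinv]
    exact (Set.subset_iUnion (fun n => φ^[n] ⁻¹' (φ^[n] '' A)) n).eventuallyLE.trans hAB
  have hforward : (⋃ n : ℕ, φ^[n] '' A : Set Ω) ≤ᵐ[μ] B := by
    simpa only [Set.iUnion_const] using Filter.EventuallyLE.countable_iUnion himage
  have hpreimage : ∀ m : ℕ, (φ^[m] ⁻¹' ⋃ n : ℕ, φ^[n] '' A : Set Ω) ≤ᵐ[μ] B := fun m => by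
    simpa only [preimage_iterate_eq_of_preimage_eq hinv] using
      (hφ.iterate m).quasiMeasurePreserving.preimage_mono_ae hforward
  rw [minimalInvariantSuperset_eq_iUnion]
  simpa only [Set.iUnion_const] using Filter.EventuallyLE.countable_iUnion hpreimage

theorem minimalInvariantSuperset_ae_eq_tailSaturation (hφ : MeasurePreserving φ μ μ)
    (hbi : Bimeasurable φ) (h : tailSigma φ ≤ completionWithin (MeasurableSpace.invariants φ) μ)
    (hA : MeasurableSet A) : minimalInvariantSuperset φ A =ᵐ[μ] tailSaturation φ A := by
  obtain ⟨-, B, hB, hAB⟩ := h _ (measurableSet_tailSaturation hbi hA)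
  exact ((minimalInvariantSuperset_ae_le hφ hbi hA hB hAB.le).trans_eq hAB.symm).antisymm
    (tailSaturation_subset_minimalInvariantSuperset φ A).eventuallyLE

theorem tendsto_image_iterate [IsFiniteMeasure μ] (hφ : MeasurePreserving φ μ μ)
    (hbi : Bimeasurable φ) (h : tailSigma φ ≤ completionWithin (MeasurableSpace.invariants φ) μ)
    (hA : MeasurableSet A) :
    Tendsto (fun n : ℕ => MeasureAlgebra.mk μ (φ^[n] '' A) (hbi.measurableSet_iterate_image n hA))
      atTop (𝓝 (MeasureAlgebra.mk μ (minimalInvariantSuperset φ A)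
        (measurableSet_minimalInvariantSuperset hbi hA))) := by
  have himage := fun n : ℕ =>
    (hbi.measurableSet_iterate_image n hA).nullMeasurableSet (μ := μ)
  have hmeasure : Tendsto (fun n : ℕ => μ (φ^[n] '' A)) atTop
      (𝓝 (μ (minimalInvariantSuperset φ A))) := by
    rw [measure_congr (minimalInvariantSuperset_ae_eq_tailSaturation hφ hbi h hA)]
    exact (tendsto_measure_iUnion_atTop (monotone_preimage_image_iterate φ A)).congr fun n =>
      (hφ.iterate n).measure_preimage (himage n)
  rw [tendsto_iff_edist_tendsto_0]
  simp_rw [MeasureAlgebra.edist_mk]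
  exact tendsto_measure_symmDiff_of_subset himage
    (image_iterate_subset_minimalInvariantSuperset φ A) (measure_ne_top _ _) hmeasure

theorem preimage_ae_eq_of_tendsto_image_iterate (hφ : MeasurePreserving φ μ μ)
    (hbi : Bimeasurable φ) (hA : MeasurableSet A) (htail : MeasurableSet[tailSigma φ] A)
    {L : MeasureAlgebra μ}
    (hL : Tendsto (fun n : ℕ => MeasureAlgebra.mk μ (φ^[n] '' A)
      (hbi.measurableSet_iterate_image n hA)) atTop (𝓝 L)) : φ ⁻¹' A =ᵐ[μ] A := by
  obtain ⟨C, rfl⟩ := SeparationQuotient.surjective_mk L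
  have hC := SeparationQuotient.isInducing_mk.tendsto_nhds_iff.2 hL
  rw [← measure_symmDiff_eq_zero_iff]
  refine EMetric.inseparable_iff.1 (inseparable_of_tendsto_of_iterate_eq
    (isometry_preimageMeasuredSets hφ) (x := ⟨A, hA⟩) (fun n => SetLike.coe_injective ?_) hC)
  exact (coe_preimageMeasuredSets_iterate hφ.measurable n _).trans
    (preimage_image_iterate_of_tailSigma htail n)

end Invariance

section Operator

variable {Ω : Type*} [mΩ : MeasurableSpace Ω] {μ : Measure Ω} {φ : Ω → Ω}

theorem condExpInv_comp_iterate (hφ : Measure.QuasiMeasurePreserving φ μ μ) (n : ℕ)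
    (f : Lp ℝ 1 μ) :
    condExpInv μ φ f ∘ φ^[n] =ᵐ[μ] μ[f | MeasurableSpace.invariants φ] := by
  have hcoe : condExpInv μ φ f =ᵐ[μ] μ[f | MeasurableSpace.invariants φ] :=
    integrable_condExp.coeFn_toL1
  have hinv : μ[f | MeasurableSpace.invariants φ] ∘ φ^[n] = μ[f | MeasurableSpace.invariants φ] :=
    MeasurableSpace.comp_eq_of_measurable_invariants <| stronglyMeasurable_condExp.measurable.mono
      (MeasurableSpace.le_invariants_iterate φ n) le_rfl
  exact ((hφ.iterate n).ae_eq_comp hcoe).trans (.of_eq hinv)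

variable [IsProbabilityMeasure μ]

theorem setIntegral_perronFrobenius_pow (hφ : MeasurePreserving φ μ μ) (n : ℕ) (f : Lp ℝ 1 μ)
    {A : Set Ω} (hA : MeasurableSet A) :
    ∫ x in A, (perronFrobenius hφ ^ n) f x ∂μ = ∫ x in φ^[n] ⁻¹' A, f x ∂μ := by
  induction n generalizing A with
  | zero => rfl
  | succ n ih =>
    rw [pow_succ', mul_apply_eq_comp, setIntegral_perronFrobenius hφ _ hA,
      ih (hφ.measurable hA), ← Set.preimage_comp, Function.iterate_succ']

theorem perronFrobenius_pow_comp_iterate (hφ : MeasurePreserving φ μ μ) (n : ℕ) (f : Lp ℝ 1 μ) :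
    (perronFrobenius hφ ^ n) f ∘ φ^[n] =ᵐ[μ] μ[f | MeasurableSpace.comap (φ^[n]) mΩ] := by
  have hn := hφ.iterate n
  set g := (perronFrobenius hφ ^ n) f with hg
  refine ae_eq_condExp_of_forall_setIntegral_eq hn.measurable.comap_le (L1.integrable_coeFn f)
    (fun _ _ _ => (hn.integrable_comp_of_integrable (L1.integrable_coeFn g)).integrableOn) ?_
    ((Lp.stronglyMeasurable g).comp_measurable (comap_measurable φ^[n])).aestronglyMeasurable
  rintro _ ⟨A, hA, rfl⟩ -
  calc ∫ x in φ^[n] ⁻¹' A, (g ∘ φ^[n]) x ∂μ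
      = ∫ x in A, g x ∂μ.map φ^[n] :=
        (setIntegral_map hA (by rw [hn.map_eq]; exact Lp.aestronglyMeasurable g)
          hn.aemeasurable).symm
    _ = ∫ x in φ^[n] ⁻¹' A, f x ∂μ := by
        rw [hn.map_eq, hg, setIntegral_perronFrobenius_pow hφ n f hA]

theorem edist_perronFrobenius_pow (hφ : MeasurePreserving φ μ μ) (n : ℕ) (f g : Lp ℝ 1 μ) :
    edist ((perronFrobenius hφ ^ n) f) g =
      eLpNorm (μ[f | MeasurableSpace.comap (φ^[n]) mΩ] - g ∘ φ^[n]) 1 μ := by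
  rw [Lp.edist_def, ← eLpNorm_comp_measurePreserving
    ((Lp.aestronglyMeasurable _).sub (Lp.aestronglyMeasurable _)) (hφ.iterate n)]
  exact eLpNorm_congr_ae ((perronFrobenius_pow_comp_iterate hφ n f).sub EventuallyEq.rfl)

theorem tendsto_perronFrobenius_pow (hφ : MeasurePreserving φ μ μ)
    (h : tailSigma φ ≤ completionWithin (MeasurableSpace.invariants φ) μ) (f : Lp ℝ 1 μ) :
    Tendsto (fun n : ℕ => (perronFrobenius hφ ^ n) f) atTop (𝓝 (condExpInv μ φ f)) := by
  have hlimit : ∀ n : ℕ, μ[f | tailSigma φ] =ᵐ[μ] condExpInv μ φ f ∘ φ^[n] := fun n =>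
    (condExp_ae_eq_of_le_completionWithin (invariants_le_tailSigma φ) h
      (L1.integrable_coeFn f)).symm.trans
        (condExpInv_comp_iterate hφ.quasiMeasurePreserving n f).symm
  rw [tendsto_iff_edist_tendsto_0]
  refine (tendsto_eLpNorm_one_condExp_iInf (antitone_comap_iterate hφ.measurable)
    (fun n => (hφ.measurable.iterate n).comap_le) (L1.integrable_coeFn f)).congr fun n => ?_
  rw [edist_perronFrobenius_pow]
  exact eLpNorm_congr_ae (EventuallyEq.rfl.sub (hlimit n))

theorem compMeasurePreserving_perronFrobenius_pow (hφ : MeasurePreserving φ μ μ) {n : ℕ}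
    {f : Lp ℝ 1 μ} (hf : AEStronglyMeasurable[MeasurableSpace.comap (φ^[n]) mΩ] f μ) :
    Lp.compMeasurePreserving φ^[n] (hφ.iterate n) ((perronFrobenius hφ ^ n) f) = f :=
  Lp.ext <| (Lp.coeFn_compMeasurePreserving _ _).trans <|
    (perronFrobenius_pow_comp_iterate hφ n f).trans <|
      condExp_of_aestronglyMeasurable' (hφ.measurable.iterate n).comap_le hf
        (L1.integrable_coeFn f)

theorem compMeasurePreserving_eq_of_tendsto_perronFrobenius_pow (hφ : MeasurePreserving φ μ μ)
    {f g : Lp ℝ 1 μ} (hf : AEStronglyMeasurable[tailSigma φ] f μ)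
    (hg : Tendsto (fun n : ℕ => (perronFrobenius hφ ^ n) f) atTop (𝓝 g)) :
    Lp.compMeasurePreserving φ hφ f = f := by
  refine (inseparable_of_tendsto_of_iterate_eq (Lp.isometry_compMeasurePreserving hφ)
    (fun n => ?_) hg).eq
  rw [Lp.compMeasurePreserving_iterate]
  exact compMeasurePreserving_perronFrobenius_pow hφ (hf.mono (iInf_le _ n))

theorem preimage_ae_eq_of_tendsto_perronFrobenius_pow (hφ : MeasurePreserving φ μ μ) {A : Set Ω}
    (hA : MeasurableSet A) (htail : MeasurableSet[tailSigma φ] A) {g : Lp ℝ 1 μ}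
    (hg : Tendsto (fun n : ℕ => (perronFrobenius hφ ^ n)
      (indicatorConstLp 1 hA (measure_ne_top μ A) (1 : ℝ))) atTop (𝓝 g)) :
    φ ⁻¹' A =ᵐ[μ] A := by
  have hf : AEStronglyMeasurable[tailSigma φ]
      (indicatorConstLp 1 hA (measure_ne_top μ A) (1 : ℝ)) μ :=
    mem_lpMeas_indicatorConstLp (𝕜 := ℝ) (tailSigma_le φ) htail (measure_ne_top μ A)
  have h := compMeasurePreserving_eq_of_tendsto_perronFrobenius_pow hφ hf hg
  rw [Lp.indicatorConstLp_compMeasurePreserving] at h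
  exact (indicatorConstLp_inj _ _ _ _ one_ne_zero).1 h

end Operator

end PerronFrobenius

theorem theorem1p1 {Ω : Type*} [MeasurableSpace Ω] (μ : Measure Ω) [IsProbabilityMeasure μ]
    (φ : Ω → Ω) (hφ : MeasurePreserving φ μ μ) (hbi : PerronFrobenius.Bimeasurable φ) :
    [∀ (A : Set Ω) (hA : MeasurableSet A), ∃ L : PerronFrobenius.MeasureAlgebra μ,
        Tendsto (fun n : ℕ => PerronFrobenius.MeasureAlgebra.mk μ (φ^[n] '' A)
          (hbi.measurableSet_iterate_image n hA)) atTop (𝓝 L),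
      ∀ f : Lp ℝ 1 μ, ∃ g : Lp ℝ 1 μ,
        Tendsto (fun n : ℕ => (PerronFrobenius.perronFrobenius hφ ^ n) f) atTop (𝓝 g),
      PerronFrobenius.completionWithin (PerronFrobenius.tailSigma φ) μ =
        PerronFrobenius.completionWithin (MeasurableSpace.invariants φ) μ].TFAE ∧
    (PerronFrobenius.completionWithin (PerronFrobenius.tailSigma φ) μ =
        PerronFrobenius.completionWithin (MeasurableSpace.invariants φ) μ →
      (∀ f : Lp ℝ 1 μ,
        Tendsto (fun n : ℕ => (PerronFrobenius.perronFrobenius hφ ^ n) f) atTop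
          (𝓝 (PerronFrobenius.condExpInv μ φ f))) ∧
      (∀ (A : Set Ω) (hA : MeasurableSet A),
        ∃ hA' : MeasurableSet (PerronFrobenius.minimalInvariantSuperset φ A),
          Tendsto (fun n : ℕ => PerronFrobenius.MeasureAlgebra.mk μ (φ^[n] '' A)
            (hbi.measurableSet_iterate_image n hA)) atTop
            (𝓝 (PerronFrobenius.MeasureAlgebra.mk μ
              (PerronFrobenius.minimalInvariantSuperset φ A) hA')))) := by
  rw [PerronFrobenius.completionWithin_eq_iff_le (PerronFrobenius.invariants_le_tailSigma φ)
    (PerronFrobenius.tailSigma_le φ)]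
  refine ⟨?_, fun h => ⟨PerronFrobenius.tendsto_perronFrobenius_pow hφ h, fun A hA =>
    ⟨PerronFrobenius.measurableSet_minimalInvariantSuperset hbi hA,
      PerronFrobenius.tendsto_image_iterate hφ hbi h hA⟩⟩⟩
  tfae_have 3 → 1 := fun h A hA => ⟨_, PerronFrobenius.tendsto_image_iterate hφ hbi h hA⟩
  tfae_have 3 → 2 := fun h f => ⟨_, PerronFrobenius.tendsto_perronFrobenius_pow hφ h f⟩
  tfae_have 1 → 3 := fun h => PerronFrobenius.tailSigma_le_completionWithin_invariants
    hφ.quasiMeasurePreserving fun A hA =>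
      let hA' := PerronFrobenius.tailSigma_le φ A hA
      PerronFrobenius.preimage_ae_eq_of_tendsto_image_iterate hφ hbi hA' hA (h A hA').choose_spec
  tfae_have 2 → 3 := fun h => PerronFrobenius.tailSigma_le_completionWithin_invariants
    hφ.quasiMeasurePreserving fun A hA =>
      PerronFrobenius.preimage_ae_eq_of_tendsto_perronFrobenius_pow hφ
        (PerronFrobenius.tailSigma_le φ A hA) hA (h _).choose_spec
  tfae_finish
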